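/- Every ordinal $\kappa$ is identified with the set of all smaller ordinals, endowed with the order topology, and $C_p(\kappa)$ denotes the space of all continuous functions $\kappa\to\mathbb{R}$ with the topology of pointwise convergence. A topological space $X$ is called a $k_{\mathbb{R}}$-space if a function $f\colon X\to\mathbb{R}$ is continuous if and only if its restriction $f|_K$ is continuous for every compact $K\subseteq X$. It is called Fréchet–Urysohn if every point in the closure of a set $A\subseteq X$ is the limit of a sequence of points of $A$. It is called an Ascoli space if every compact subset $\mathcal{K}$ of the space $C(X,\mathbb{R})$ of continuous real-valued functions with the compact-open topology is evenly continuous; that is, for all $x\in X$, $y\in\mathbb{R}$ and every neighbourhood $V$ of $y$ there are neighbourhoods $U$ of $x$ and $W$ of $y$ such that $f(U)\subseteq V$ for every $f\in\mathcal{K}$ with $f(x)\in W$. Theorem. For every ordinal $\kappa$ the following are equivalent: (i) $C_p(\kappa)$ is a $k_{\mathbb{R}}$-space; (ii) $\mathrm{cf}(\kappa)\le\omega$ (where $\mathrm{cf}(0)=0$ and $\mathrm{cf}(\kappa)=1$ for a successor ordinal $\kappa$); (iii) $C_p(\kappa)$ is a Fréchet–Urysohn space. Moreover, $C_p(\omega_1)$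 is an Ascoli space that is not a $k_{\mathbb{R}}$-space. -/

import Mathlib

open Topology Cardinal

universe u

/-- `C_p(X)`: the continuous real-valued functions on `X` with the topology of pointwise
convergence, i.e. the subspace topology inherited from the product space `X → ℝ`. -/
abbrev Cp (X : Type*) [TopologicalSpace X] : Type _ := {f : X → ℝ // Continuous f}

/-- The space of an ordinal `κ`: the set of all ordinals smaller than `κ`. Its topology (as a
subspace of the ordinals) is the order topology, see `ordinalSpace_orderTopology`. -/
abbrev OrdinalSpace (κ : Ordinal.{u}) : Type (u + 1) := Set.Iio κ

theorem ordinalSpace_orderTopology (κ : Ordinal.{u}) : OrderTopology (OrdinalSpace κ) :=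
  inferInstance

/-- `X` is a `k_ℝ`-space: a real-valued function on `X` is continuous if and only if its
restriction to every compact subset of `X` is continuous. -/
def IsKRSpace (X : Type*) [TopologicalSpace X] : Prop :=
  ∀ f : X → ℝ, Continuous f ↔ ∀ K : Set X, IsCompact K → ContinuousOn f K

/-- A set `F` of continuous real-valued functions on `X` is evenly continuous: for all `x : X`,
`y : ℝ` and every neighbourhood `V` of `y` there are neighbourhoods `U` of `x` and `W` of `y` such
that every `f ∈ F` with `f x ∈ W` maps `U` into `V`. -/
def EvenlyContinuous {X : Type*} [TopologicalSpace X] (F : Set C(X, ℝ)) : Prop :=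
  ∀ (x : X) (y : ℝ), ∀ V ∈ 𝓝 y, ∃ U ∈ 𝓝 x, ∃ W ∈ 𝓝 y, ∀ f ∈ F, f x ∈ W → ∀ z ∈ U, f z ∈ V

/-- `X` is an Ascoli space: every compact subset of `C(X, ℝ)`, which carries the compact-open
topology, is evenly continuous. -/
def IsAscoliSpace (X : Type*) [TopologicalSpace X] : Prop :=
  ∀ K : Set C(X, ℝ), IsCompact K → EvenlyContinuous K

/-!
All the constructions below choose a sequence whose `n`-th term depends on the finite set of the
earlier terms; `exists_seq_of_forall_finite` provides such sequences.

*Countable cofinality implies Fréchet–Urysohn.* An ordinal of cofinality at most `ω` is a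
`σ`-compact well-ordered space, with compact pieces `K₀ ⊆ K₁ ⊆ ⋯`. Given `f` in the closure of `A`,
choose `gₙ ∈ A` with `|gₙ - f| < 1 / (n + 1)` at the greatest point of `K_j \ ⋃ S`, for all `j ≤ n`
and all families `S` of the open sets `Uᵢ = {|gᵢ - f| < 1 / (i + 1)}`, `i < n`. If some `x ∈ K_j`
missed infinitely many `Uₙ`, the greatest points of what the first `k` of these leave uncovered in
`K_j` would decrease infinitely often, against well-foundedness. So `gₙ → f` pointwise
(`frechetUrysohnSpace_Cp`). A Fréchet–Urysohn space is a `k_ℝ`-space since a convergent sequence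
together with its limit is compact.

*Uncountable cofinality excludes `k_ℝ`.* Every continuous function is then eventually constant. The
functional `Φ` sending `f` to its eventual value is discontinuous, because no finite set of points
determines it. It is continuous on compact sets `K`: otherwise there are `ε > 0`, `f ∈ K`, functions
`gₙ ∈ K` with `|Φ gₙ - Φ f| ≥ ε`, and points `x₀ ≤ x₁ ≤ ⋯` beyond which `f` and the `gₙ` are
constant, with `gₙ` tending to `f` at each `xᵢ`. A cluster point `g ∈ K` of the `gₙ` equals `Φ f` at
each `xᵢ`, hence at their supremum `β`, whereas `|gₙ β - Φ f| ≥ ε` for all `n`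
(`not_isKRSpace_Cp`).

*`C_p(ω₁)` is Ascoli.* It has the `κ`-Fréchet–Urysohn property: points in the closure of an open set
`U` are limits of sequences in `U`. Membership in the open set `U` is witnessed by finitely many
coordinates, so a function `gₙ ∈ U` may be replaced by `f` above a countable ordinal `bₙ`, and
it remains to approximate `f` on the countable set `⋃ₙ [0, bₙ]`
(`isKappaFrechetUrysohn_Cp`). In such a space a compact set of functions is equicontinuous: a
failure at `x` would take place along a sequence converging to `x`, and on this compact sequence the
functions cluster uniformly (`IsKappaFrechetUrysohn.isAscoliSpace`).
-/

open Filter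

/-! ### Sequences chosen with memory -/

/-- A sequence may be chosen so that each term depends on its index and on the (finite) set of all
earlier terms. -/
theorem exists_seq_of_forall_finite {α : Type*} {P : ℕ → Set α → α → Prop}
    (h : ∀ n T, T.Finite → ∃ a, P n T a) : ∃ a : ℕ → α, ∀ n, P n (a '' Set.Iio n) (a n) := by
  choose G hG using h
  let T : ℕ → {T : Set α // T.Finite} := fun n ↦
    Nat.rec ⟨∅, Set.finite_empty⟩ (fun n T ↦ ⟨insert (G n T.1 T.2) T.1, T.2.insert _⟩) n
  have hT : ∀ n, (fun n ↦ G n (T n).1 (T n).2) '' Set.Iio n = (T n).1 := by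
    intro n
    induction n with
    | zero => simp [T]
    | succ n ih =>
      have : Set.Iio (n + 1) = insert n (Set.Iio n) := by
        ext k; simp only [Set.mem_Iio, Set.mem_insert_iff]; omega
      rw [this, Set.image_insert_eq, ih]
  refine ⟨fun n ↦ G n (T n).1 (T n).2, fun n ↦ ?_⟩
  rw [hT]
  exact hG _ _ _

/-! ### The topology of pointwise convergence -/

theorem Cp.tendsto_iff {X ι : Type*} [TopologicalSpace X] {l : Filter ι} {g : ι → Cp X}
    {f : Cp X} : Tendsto g l (𝓝 f) ↔ ∀ x, Tendsto (fun i ↦ (g i).1 x) l (𝓝 (f.1 x)) := by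
  rw [tendsto_subtype_rng, tendsto_pi_nhds]

theorem Cp.continuous_eval {X : Type*} [TopologicalSpace X] (x : X) :
    Continuous fun g : Cp X ↦ g.1 x :=
  (continuous_apply x).comp continuous_subtype_val

theorem Cp.exists_mem_of_mem_closure {X : Type*} [TopologicalSpace X] {A : Set (Cp X)} {f : Cp X}
    (hf : f ∈ closure A) {F : Set X} (hF : F.Finite) {ε : ℝ} (hε : 0 < ε) :
    ∃ g ∈ A, ∀ x ∈ F, |g.1 x - f.1 x| < ε := by
  have h : ∀ᶠ g : Cp X in 𝓝 f, ∀ x ∈ F, |g.1 x - f.1 x| < ε := by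
    rw [eventually_all_finite hF]
    intro x _
    exact (Metric.tendsto_nhds.1 (Cp.continuous_eval x).continuousAt ε hε).mono fun g hg ↦ by
      rwa [← Real.dist_eq]
  obtain ⟨g, hg, hg'⟩ := ((mem_closure_iff_frequently.1 hf).and_eventually h).exists
  exact ⟨g, hg, hg'⟩

theorem Cp.exists_finite_of_isOpen {X : Type*} [TopologicalSpace X] {U : Set (Cp X)}
    (hU : IsOpen U) {g : Cp X} (hg : g ∈ U) :
    ∃ F : Set X, F.Finite ∧ ∀ h : Cp X, (∀ x ∈ F, h.1 x = g.1 x) → h ∈ U := by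
  obtain ⟨V, hV, rfl⟩ := isOpen_induced_iff.1 hU
  obtain ⟨I, u, hu, hI⟩ := isOpen_pi_iff.1 hV g.1 hg
  refine ⟨I, I.finite_toSet, fun h hh ↦ hI fun x hx ↦ ?_⟩
  rw [hh x hx]
  exact (hu x hx).2

/-! ### Fréchet–Urysohn function spaces -/

theorem isKRSpace_of_frechetUrysohnSpace (X : Type*) [TopologicalSpace X]
    [FrechetUrysohnSpace X] : IsKRSpace X := by
  refine fun f ↦ ⟨fun h K _ ↦ h.continuousOn, fun h ↦ SeqContinuous.continuous ?_⟩
  intro u x hu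
  have hx := h _ hu.isCompact_insert_range x (Set.mem_insert _ _)
  exact hx.tendsto.comp (tendsto_nhdsWithin_iff.2
    ⟨hu, Eventually.of_forall fun n ↦ Set.mem_insert_of_mem _ (Set.mem_range_self n)⟩)

theorem frechetUrysohnSpace_Cp (X : Type*) [LinearOrder X] [WellFoundedLT X] [TopologicalSpace X]
    [OrderTopology X] [SigmaCompactSpace X] : FrechetUrysohnSpace (Cp X) := by
  refine ⟨fun A f hf ↦ ?_⟩
  let P : ℕ → Set (Set X) → Set X → Prop := fun n T U ↦
    IsOpen U ∧ (∃ g ∈ A, ∀ x ∈ U, |g.1 x - f.1 x| < 1 / ((n : ℝ) + 1)) ∧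
      ∀ S ⊆ T, ∀ j ≤ n, ∀ m, IsGreatest (compactCovering X j \ ⋃₀ S) m → m ∈ U
  have hP : ∀ n T, T.Finite → ∃ U, P n T U := by
    intro n T hT
    have hF : (⋃ S ∈ {S | S ⊆ T}, ⋃ j ∈ Set.Iic n,
        {m | IsGreatest (compactCovering X j \ ⋃₀ S) m}).Finite :=
      hT.finite_subsets.biUnion fun S _ ↦ (Set.finite_Iic n).biUnion fun j _ ↦
        Set.Subsingleton.finite fun a ha b hb ↦ ha.unique hb
    obtain ⟨g, hg, hgF⟩ := Cp.exists_mem_of_mem_closure hf hF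
      (Nat.one_div_pos_of_nat (α := ℝ) (n := n))
    refine ⟨{x | |g.1 x - f.1 x| < 1 / ((n : ℝ) + 1)},
      isOpen_lt (g.2.sub f.2).abs continuous_const, ⟨g, hg, fun x hx ↦ hx⟩, ?_⟩
    intro S hS j hj m hm
    exact hgF m (Set.mem_biUnion hS (Set.mem_biUnion hj hm))
  obtain ⟨U, hU⟩ := exists_seq_of_forall_finite hP
  choose hUo hUg hUm using hU
  choose g hgA hg using hUg
  refine ⟨g, hgA, Cp.tendsto_iff.2 fun x ↦ ?_⟩
  have key : ∀ᶠ n in atTop, x ∈ U n := by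
    by_contra hx
    rw [not_eventually] at hx
    obtain ⟨j, hj⟩ := Set.mem_iUnion.1 ((iUnion_compactCovering X).symm ▸ Set.mem_univ x :
      x ∈ ⋃ j, compactCovering X j)
    let S : ℕ → Set (Set X) := fun k ↦ U '' {i | i < k ∧ x ∉ U i}
    have hm : ∀ k, ∃ m, IsGreatest (compactCovering X j \ ⋃₀ S k) m := by
      refine fun k ↦ ((isCompact_compactCovering X j).diff (isOpen_sUnion ?_)).exists_isGreatest
        ⟨x, hj, ?_⟩
      · rintro _ ⟨i, _, rfl⟩
        exact hUo i
      · rintro ⟨_, ⟨i, hi, rfl⟩, hxi⟩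
        exact hi.2 hxi
    choose m hm using hm
    have hanti : Antitone m := by
      intro k l hkl
      refine (hm k).2 ⟨(hm l).1.1, fun h ↦ (hm l).1.2 (Set.sUnion_mono ?_ h)⟩
      exact Set.image_mono fun i hi ↦ ⟨hi.1.trans_le hkl, hi.2⟩
    obtain ⟨_, ⟨k, rfl⟩, hk⟩ := (wellFounded_lt (α := X)).has_min (Set.range m)
      (Set.range_nonempty m)
    obtain ⟨n, hxn, hn⟩ := (hx.and_eventually (eventually_ge_atTop (max k j))).exists
    have hmn : m n ∈ U n := hUm n (S n) (Set.image_mono fun i hi ↦ hi.1) j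
      ((le_max_right _ _).trans hn) _ (hm n)
    have hne : m (n + 1) ≠ m n := fun h ↦
      (hm (n + 1)).1.2 ⟨U n, ⟨n, ⟨n.lt_succ_self, hxn⟩, rfl⟩, h ▸ hmn⟩
    exact hk _ ⟨n + 1, rfl⟩ (((hanti n.le_succ).lt_of_ne hne).trans_le
      (hanti ((le_max_left _ _).trans hn)))
  rw [tendsto_iff_dist_tendsto_zero]
  refine squeeze_zero' (Eventually.of_forall fun n ↦ dist_nonneg) (key.mono fun n hn ↦ ?_)
    (tendsto_one_div_add_atTop_nhds_zero_nat (𝕜 := ℝ))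
  rw [Real.dist_eq]
  exact (hg n x hn).le

/-! ### Well-ordered spaces -/

theorem exists_tendsto_of_monotone {X : Type*} [LinearOrder X] [WellFoundedLT X]
    [TopologicalSpace X] [OrderTopology X] {a : ℕ → X} (ha : Monotone a)
    (hb : BddAbove (Set.range a)) : ∃ b, Tendsto a atTop (𝓝 b) := by
  obtain ⟨b, hb, hmin⟩ := (wellFounded_lt (α := X)).has_min _ hb
  exact ⟨b, tendsto_atTop_isLUB ha ⟨hb, fun c hc ↦ not_lt.1 (hmin c hc)⟩⟩

theorem isClopen_Iic_of_wellFoundedLT {X : Type*} [LinearOrder X] [WellFoundedLT X]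
    [TopologicalSpace X] [OrderTopology X] (b : X) : IsClopen (Set.Iic b) := by
  refine ⟨isClosed_Iic, ?_⟩
  rcases (Set.Ioi b).eq_empty_or_nonempty with h | h
  · have : Set.Iic b = Set.univ := by rw [← Set.compl_Ioi, h, Set.compl_empty]
    exact this ▸ isOpen_univ
  · obtain ⟨c, hc, hmin⟩ := (wellFounded_lt (α := X)).has_min _ h
    have : Set.Iic b = Set.Iio c := by
      ext y
      exact ⟨fun hy ↦ lt_of_le_of_lt hy hc, fun hy ↦ not_lt.1 fun h ↦ hmin y h hy⟩
    exact this ▸ isOpen_Iio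

/-- The continuous function that equals `g` up to `b` and `f` above `b`. -/
noncomputable def Cp.splice {X : Type*} [LinearOrder X] [WellFoundedLT X]
    [TopologicalSpace X] [OrderTopology X] (b : X) (g f : Cp X) : Cp X := by
  classical
  exact ⟨(Set.Iic b).piecewise g.1 f.1, g.2.piecewise
    (by simp [(isClopen_Iic_of_wellFoundedLT b).frontier_eq]) f.2⟩

theorem Cp.splice_of_le {X : Type*} [LinearOrder X] [WellFoundedLT X]
    [TopologicalSpace X] [OrderTopology X] {b x : X} (g f : Cp X) (h : x ≤ b) :
    (Cp.splice b g f).1 x = g.1 x := by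
  classical exact Set.piecewise_eq_of_mem (Set.Iic b) _ _ (Set.mem_Iic.2 h)

theorem Cp.splice_of_lt {X : Type*} [LinearOrder X] [WellFoundedLT X]
    [TopologicalSpace X] [OrderTopology X] {b x : X} (g f : Cp X) (h : b < x) :
    (Cp.splice b g f).1 x = f.1 x := by
  classical exact Set.piecewise_eq_of_notMem (Set.Iic b) _ _ (mt Set.mem_Iic.1 (not_le.2 h))

/-! ### Eventual values of continuous functions -/

theorem exists_eventually_const {X : Type*} [LinearOrder X] [WellFoundedLT X]
    [TopologicalSpace X] [OrderTopology X] (hX : ∀ s : Set X, s.Countable → BddAbove s)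
    (f : Cp X) : ∃ b, ∀ x, b ≤ x → f.1 x = f.1 b := by
  have hosc : ∀ ε : ℝ, 0 < ε → ∃ b, ∀ x, b ≤ x → |f.1 x - f.1 b| < ε := by
    intro ε hε
    by_contra! h
    choose u hu hfu using h
    obtain ⟨x₀, _⟩ := hX ∅ Set.countable_empty
    -- Iterating `u` gives a convergent sequence along which `f` jumps by `ε` at each step.
    have hsucc : ∀ n, u^[n + 1] x₀ = u (u^[n] x₀) := fun n ↦ Function.iterate_succ_apply' u n x₀
    obtain ⟨b, hb⟩ := exists_tendsto_of_monotone (a := fun n ↦ u^[n] x₀)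
      (monotone_nat_of_le_succ fun n ↦ by simpa only [hsucc] using hu _)
      (hX _ (Set.countable_range _))
    have h1 := (f.2.tendsto b).comp hb
    have h2 := (((tendsto_add_atTop_iff_nat 1).2 h1).sub h1).abs
    rw [sub_self, abs_zero] at h2
    obtain ⟨n, hn⟩ := (h2.eventually_lt_const hε).exists
    refine (hfu (u^[n] x₀)).not_gt ?_
    simpa only [Function.comp_apply, hsucc] using hn
  choose c hc using fun n : ℕ ↦ hosc (1 / ((n : ℝ) + 1)) Nat.one_div_pos_of_nat
  obtain ⟨b, hb⟩ := hX _ (Set.countable_range c)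
  refine ⟨b, fun x hx ↦ ?_⟩
  have hlim : Tendsto (fun n : ℕ ↦ 1 / ((n : ℝ) + 1) + 1 / ((n : ℝ) + 1)) atTop (𝓝 0) := by
    simpa using (tendsto_one_div_add_atTop_nhds_zero_nat (𝕜 := ℝ)).add
      tendsto_one_div_add_atTop_nhds_zero_nat
  refine sub_eq_zero.1 (abs_nonpos_iff.1 (ge_of_tendsto' hlim fun n ↦ ?_))
  have hcb : c n ≤ b := hb ⟨n, rfl⟩
  have h1 := abs_lt.1 (hc n x (hcb.trans hx))
  have h2 := abs_lt.1 (hc n b hcb)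
  exact abs_le.2 ⟨by linarith, by linarith⟩

/-- The functional `Φ` sending a function to its eventual value is continuous on compact sets. The
points `b g` are such that `g` equals `Φ g` from `b g` on. -/
theorem continuousOn_eventualValue {X : Type*} [LinearOrder X] [WellFoundedLT X]
    [TopologicalSpace X] [OrderTopology X] (hX : ∀ s : Set X, s.Countable → BddAbove s)
    {Φ : Cp X → ℝ} {b : Cp X → X} (hΦ : ∀ g x, b g ≤ x → g.1 x = Φ g)
    {K : Set (Cp X)} (hK : IsCompact K) : ContinuousOn Φ K := by
  intro f hf
  refine Metric.tendsto_nhds.2 fun ε hε ↦ ?_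
  by_contra hcon
  have hcl : f ∈ closure {g | g ∈ K ∧ ε ≤ |Φ g - Φ f|} := by
    rw [mem_closure_iff_frequently]
    rw [not_eventually, frequently_nhdsWithin_iff] at hcon
    exact hcon.mono fun g hg ↦ ⟨hg.2, by rw [← Real.dist_eq]; exact not_lt.1 hg.1⟩
  let P : ℕ → Set (Cp X × X) → Cp X × X → Prop := fun n T p ↦
    (p.1 ∈ K ∧ ε ≤ |Φ p.1 - Φ f|) ∧ b p.1 ≤ p.2 ∧ b f ≤ p.2 ∧
      ∀ q ∈ T, q.2 ≤ p.2 ∧ |p.1.1 q.2 - f.1 q.2| < 1 / ((n : ℝ) + 1)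
  have hP : ∀ n T, T.Finite → ∃ p, P n T p := by
    intro n T hT
    obtain ⟨g, hg, hgT⟩ := Cp.exists_mem_of_mem_closure hcl (hT.image Prod.snd)
      (Nat.one_div_pos_of_nat (α := ℝ) (n := n))
    obtain ⟨x, hx⟩ := hX ({b g, b f} ∪ Prod.snd '' T)
      ((((Set.finite_singleton _).insert _).union (hT.image _)).countable)
    exact ⟨(g, x), hg, hx (by simp), hx (by simp), fun q hq ↦
      ⟨hx (Or.inr ⟨q, hq, rfl⟩), hgT _ ⟨q, hq, rfl⟩⟩⟩
  obtain ⟨a, ha⟩ := exists_seq_of_forall_finite hP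
  choose haK hab haf haT using ha
  have hmono : Monotone fun n ↦ (a n).2 := monotone_nat_of_le_succ fun n ↦
    (haT (n + 1) _ ⟨n, n.lt_succ_self, rfl⟩).1
  obtain ⟨β, hβ⟩ := exists_tendsto_of_monotone hmono (hX _ (Set.countable_range _))
  have hle : ∀ n, (a n).2 ≤ β := hmono.ge_of_tendsto hβ
  obtain ⟨g, -, hg⟩ := hK.exists_mapClusterPt (f := atTop) (u := fun n ↦ (a n).1)
    (tendsto_principal.2 (Eventually.of_forall fun n ↦ (haK n).1))
  have heval : ∀ x, MapClusterPt (g.1 x) atTop fun n ↦ (a n).1.1 x := fun x ↦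
    hg.tendsto_comp (Cp.continuous_eval x).continuousAt
  have hgx : ∀ i, g.1 (a i).2 = Φ f := by
    intro i
    have hlim : Tendsto (fun n ↦ (a n).1.1 (a i).2) atTop (𝓝 (Φ f)) := by
      rw [← hΦ f _ (haf i), tendsto_iff_dist_tendsto_zero]
      refine squeeze_zero' (Eventually.of_forall fun n ↦ dist_nonneg) ?_
        (tendsto_one_div_add_atTop_nhds_zero_nat (𝕜 := ℝ))
      filter_upwards [eventually_gt_atTop i] with n hn
      rw [Real.dist_eq]
      exact (haT n _ ⟨i, hn, rfl⟩).2.le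
    have hne : (𝓝 (g.1 (a i).2) ⊓ 𝓝 (Φ f)).NeBot :=
      (heval (a i).2).clusterPt.mono hlim
    exact eq_of_nhds_neBot hne
  have hgβ : g.1 β = Φ f := by
    refine tendsto_nhds_unique ((g.2.tendsto β).comp hβ) ?_
    exact tendsto_const_nhds.congr fun i ↦ (hgx i).symm
  have hmem : g.1 β ∈ {y : ℝ | ε ≤ |y - Φ f|} := by
    refine IsClosed.mem_of_mapClusterPt ?_ (heval β) (Eventually.of_forall fun n ↦ ?_)
    · exact isClosed_le continuous_const (continuous_id.sub continuous_const).abs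
    · change ε ≤ |(a n).1.1 β - Φ f|
      rw [hΦ (a n).1 β ((hab n).trans (hle n))]
      exact (haK n).2
  have : ε ≤ |g.1 β - Φ f| := hmem
  rw [hgβ, sub_self, abs_zero] at this
  exact this.not_gt hε

theorem not_isKRSpace_Cp {X : Type*} [LinearOrder X] [WellFoundedLT X]
    [TopologicalSpace X] [OrderTopology X] [NoMaxOrder X]
    (hX : ∀ s : Set X, s.Countable → BddAbove s) : ¬ IsKRSpace (Cp X) := by
  intro hkR
  choose b hb using exists_eventually_const hX
  have hΦ : Continuous fun g : Cp X ↦ g.1 (b g) :=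
    (hkR _).2 fun K hK ↦ continuousOn_eventualValue hX hb hK
  let c : ℝ → Cp X := fun r ↦ ⟨fun _ ↦ r, continuous_const⟩
  obtain ⟨F, hF, hFU⟩ := Cp.exists_finite_of_isOpen (isOpen_Iio.preimage hΦ)
    (show c 0 ∈ (fun g : Cp X ↦ g.1 (b g)) ⁻¹' Set.Iio 1 from zero_lt_one (α := ℝ))
  obtain ⟨x, hx⟩ := hX F hF.countable
  obtain ⟨y, hy⟩ := exists_gt x
  let h := Cp.splice x (c 0) (c 1)
  have h1 : h.1 (b h) < 1 := hFU h fun z hz ↦ Cp.splice_of_le _ _ (hx hz)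
  rw [← hb h _ (le_max_right y (b h))] at h1
  exact h1.ne (Cp.splice_of_lt _ _ (hy.trans_le (le_max_left y (b h))))

/-! ### The Ascoli property -/

/-- `X` is a `κ`-Fréchet–Urysohn space: every point in the closure of an open set `U` is the limit
of a sequence of points of `U`. (The letter `κ` is part of the name, not a cardinal.) -/
def IsKappaFrechetUrysohn (X : Type*) [TopologicalSpace X] : Prop :=
  ∀ U : Set X, IsOpen U → closure U ⊆ seqClosure U

theorem isKappaFrechetUrysohn_Cp {X : Type*} [LinearOrder X] [WellFoundedLT X]
    [TopologicalSpace X] [OrderTopology X] [Nonempty X] (hX : ∀ b : X, (Set.Iic b).Countable) :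
    IsKappaFrechetUrysohn (Cp X) := by
  intro U hU f hf
  choose e he using fun b ↦ Set.countable_iff_exists_injOn.1 (hX b)
  let P : ℕ → Set (Cp X × X) → Cp X × X → Prop := fun n T p ↦
    Cp.splice p.2 p.1 f ∈ U ∧
      ∀ q ∈ T, ∀ x ≤ q.2, e q.2 x ≤ n → |p.1.1 x - f.1 x| < 1 / ((n : ℝ) + 1)
  have hP : ∀ n T, T.Finite → ∃ p, P n T p := by
    intro n T hT
    have hF : (⋃ q ∈ T, {x | x ≤ q.2 ∧ e q.2 x ≤ n}).Finite := by
      refine hT.biUnion fun q _ ↦ Set.Finite.of_finite_image ((Set.finite_Iic n).subset ?_)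
        ((he q.2).mono fun x hx ↦ hx.1)
      rintro _ ⟨x, hx, rfl⟩
      exact hx.2
    obtain ⟨g, hg, hgF⟩ := Cp.exists_mem_of_mem_closure hf hF
      (Nat.one_div_pos_of_nat (α := ℝ) (n := n))
    obtain ⟨E, hE, hEU⟩ := Cp.exists_finite_of_isOpen hU hg
    obtain ⟨b, hb⟩ := hE.bddAbove
    exact ⟨(g, b), hEU _ fun x hx ↦ Cp.splice_of_le _ _ (hb hx), fun q hq x hx hex ↦
      hgF x (Set.mem_biUnion hq ⟨hx, hex⟩)⟩
  obtain ⟨a, ha⟩ := exists_seq_of_forall_finite hP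
  choose haU haT using ha
  refine ⟨fun n ↦ Cp.splice (a n).2 (a n).1 f, haU, Cp.tendsto_iff.2 fun x ↦ ?_⟩
  by_cases hx : ∃ i, x ≤ (a i).2
  · obtain ⟨i, hi⟩ := hx
    rw [tendsto_iff_dist_tendsto_zero]
    refine squeeze_zero' (Eventually.of_forall fun n ↦ dist_nonneg) ?_
      (tendsto_one_div_add_atTop_nhds_zero_nat (𝕜 := ℝ))
    filter_upwards [eventually_gt_atTop i, eventually_ge_atTop (e (a i).2 x)] with n hn hen
    rw [Real.dist_eq]
    rcases le_or_gt x (a n).2 with h | h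
    · rw [Cp.splice_of_le _ _ h]
      exact (haT n _ ⟨i, hn, rfl⟩ x hi hen).le
    · rw [Cp.splice_of_lt _ _ h, sub_self, abs_zero]
      exact Nat.one_div_pos_of_nat.le
  · push Not at hx
    exact tendsto_const_nhds.congr fun n ↦ (Cp.splice_of_lt _ _ (hx n)).symm

/-- Compact sets of continuous functions on a `κ`-Fréchet–Urysohn space are equicontinuous. -/
theorem IsKappaFrechetUrysohn.exists_nhds_forall_abs_sub_le {X : Type*} [TopologicalSpace X]
    (hX : IsKappaFrechetUrysohn X) {K : Set C(X, ℝ)} (hK : IsCompact K) (x : X) {ε : ℝ}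
    (hε : 0 < ε) : ∃ U ∈ 𝓝 x, ∀ f ∈ K, ∀ z ∈ U, |f z - f x| ≤ ε := by
  by_contra! hcon
  let A : Set X := {z | ∃ f ∈ K, ε < |f z - f x|}
  have hA : IsOpen A := by
    have : A = ⋃ f ∈ K, {z | ε < |f z - f x|} := by ext z; simp [A]
    rw [this]
    exact isOpen_biUnion fun f _ ↦
      isOpen_lt continuous_const (f.continuous.sub continuous_const).abs
  have hxA : x ∈ closure A := mem_closure_iff_nhds.2 fun U hU ↦ by
    obtain ⟨f, hf, z, hz, hfz⟩ := hcon U hU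
    exact ⟨z, hz, f, hf, hfz⟩
  obtain ⟨z, hzA, hz⟩ := hX A hA hxA
  choose f hf hfz using hzA
  obtain ⟨g, -, hg⟩ := hK.exists_mapClusterPt (f := atTop) (u := f)
    (tendsto_principal.2 (Eventually.of_forall hf))
  -- On the compact set formed by `x` and the `z n`, some `f n` are uniformly close to `g`.
  have hunif := Metric.tendstoUniformlyOn_iff.1
    (ContinuousMap.tendsto_iff_forall_isCompact_tendstoUniformlyOn.1 (tendsto_id (x := 𝓝 g)) _
      hz.isCompact_insert_range) (ε / 3) (by positivity)
  have hgz := Metric.tendsto_nhds.1 ((g.continuous.tendsto x).comp hz) (ε / 3) (by positivity)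
  obtain ⟨n, hn, hn'⟩ := ((hg.frequently hunif).and_eventually hgz).exists
  have h1 := hn x (Set.mem_insert _ _)
  have h2 := hn (z n) (Set.mem_insert_of_mem _ (Set.mem_range_self n))
  have h3 := hfz n
  simp only [Real.dist_eq, id, Function.comp_apply, abs_lt] at h1 h2 hn'
  exact h3.not_ge (abs_le.2 ⟨by linarith, by linarith⟩)

theorem IsKappaFrechetUrysohn.isAscoliSpace {X : Type*} [TopologicalSpace X]
    (hX : IsKappaFrechetUrysohn X) : IsAscoliSpace X := by
  intro K hK x y V hV
  obtain ⟨ε, hε, hεV⟩ := Metric.mem_nhds_iff.1 hV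
  obtain ⟨U, hU, hUK⟩ := hX.exists_nhds_forall_abs_sub_le hK x (half_pos hε)
  refine ⟨U, hU, Metric.ball y (ε / 2), Metric.ball_mem_nhds y (half_pos hε), ?_⟩
  intro f hf hfx z hz
  refine hεV ?_
  have h1 := abs_le.1 (hUK f hf z hz)
  rw [Metric.mem_ball, Real.dist_eq, abs_lt] at hfx ⊢
  constructor <;> linarith

/-! ### Spaces of ordinals -/

theorem cof_le_aleph0_iff (κ : Ordinal.{u}) :
    κ.cof ≤ ℵ₀ ↔ ∃ s : Set (OrdinalSpace κ), s.Countable ∧ IsCofinal s := by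
  have h : Order.cof (OrdinalSpace κ) = Cardinal.lift.{u + 1} κ.cof := by
    rw [Ordinal.cof_Iio, Ordinal.lift_cof]
  rw [← Cardinal.lift_le_aleph0.{u, u + 1}, ← h]
  constructor
  · intro hκ
    obtain ⟨s, hs, hcard⟩ := Order.exists_cof_eq (OrdinalSpace κ)
    exact ⟨s, Cardinal.le_aleph0_iff_set_countable.1 (hcard ▸ hκ), hs⟩
  · rintro ⟨s, hs, hcof⟩
    exact (Order.cof_le hcof).trans (Cardinal.le_aleph0_iff_set_countable.2 hs)

theorem isCompact_Iic_ordinalSpace {κ : Ordinal.{u}} (b : OrdinalSpace κ) :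
    IsCompact (Set.Iic b) := by
  have himage : Subtype.val '' Set.Iic b = Set.Icc 0 b.1 := by
    ext y
    constructor
    · rintro ⟨x, hx, rfl⟩
      exact ⟨zero_le, hx⟩
    · exact fun hy ↦ ⟨⟨y, lt_of_le_of_lt hy.2 b.2⟩, hy.2, rfl⟩
  rw [Topology.IsEmbedding.subtypeVal.isCompact_iff, himage]
  exact isCompact_Icc

theorem sigmaCompactSpace_ordinalSpace {κ : Ordinal.{u}} (hκ : κ.cof ≤ ℵ₀) :
    SigmaCompactSpace (OrdinalSpace κ) := by
  obtain ⟨s, hs, hcof⟩ := (cof_le_aleph0_iff κ).1 hκ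
  refine SigmaCompactSpace.of_countable (Set.Iic '' s) (hs.image _) ?_ ?_
  · rintro _ ⟨b, _, rfl⟩
    exact isCompact_Iic_ordinalSpace b
  · refine Set.eq_univ_of_forall fun x ↦ ?_
    obtain ⟨b, hb, hxb⟩ := hcof x
    exact ⟨_, ⟨b, hb, rfl⟩, hxb⟩

theorem not_isKRSpace_Cp_ordinalSpace {κ : Ordinal.{u}} (hκ : ¬ κ.cof ≤ ℵ₀) :
    ¬ IsKRSpace (Cp (OrdinalSpace κ)) := by
  have hlt : ∀ s : Set (OrdinalSpace κ), s.Countable → ∃ b, ∀ y ∈ s, y < b := by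
    intro s hs
    by_contra! h
    exact hκ ((cof_le_aleph0_iff κ).2 ⟨s, hs, h⟩)
  have : NoMaxOrder (OrdinalSpace κ) := ⟨fun a ↦ by
    obtain ⟨b, hb⟩ := hlt {a} (Set.countable_singleton a)
    exact ⟨b, hb a rfl⟩⟩
  refine not_isKRSpace_Cp fun s hs ↦ ?_
  obtain ⟨b, hb⟩ := hlt s hs
  exact ⟨b, fun y hy ↦ (hb y hy).le⟩

theorem countable_Iic_omega_one (b : OrdinalSpace (Ordinal.omega.{u} 1)) :
    (Set.Iic b).Countable := by
  have hval : (Set.Iic b.1).Countable := by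
    rw [← Order.Iio_succ, ← Cardinal.le_aleph0_iff_set_countable, Cardinal.mk_Iio_ordinal,
      Cardinal.lift_le_aleph0, ← Cardinal.lt_aleph_one_iff, ← Cardinal.lt_ord, Cardinal.ord_aleph]
    exact (Cardinal.isSuccLimit_omega 1).succ_lt b.2
  exact (hval.preimage Subtype.val_injective).mono fun x hx ↦ hx

theorem theoremt :
    (∀ κ : Ordinal.{u},
      (IsKRSpace (Cp (OrdinalSpace κ)) ↔ κ.cof ≤ ℵ₀) ∧
      (κ.cof ≤ ℵ₀ ↔ FrechetUrysohnSpace (Cp (OrdinalSpace κ)))) ∧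
    IsAscoliSpace (Cp (OrdinalSpace (Ordinal.omega.{u} 1))) ∧
    ¬ IsKRSpace (Cp (OrdinalSpace (Ordinal.omega.{u} 1))) := by
  have hFU : ∀ κ : Ordinal.{u}, κ.cof ≤ ℵ₀ → FrechetUrysohnSpace (Cp (OrdinalSpace κ)) := by
    intro κ hκ
    have := sigmaCompactSpace_ordinalSpace hκ
    exact frechetUrysohnSpace_Cp _
  have hKR : ∀ κ : Ordinal.{u}, IsKRSpace (Cp (OrdinalSpace κ)) → κ.cof ≤ ℵ₀ := fun κ h ↦
    by_contra fun hκ ↦ not_isKRSpace_Cp_ordinalSpace hκ h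
  refine ⟨fun κ ↦ ⟨⟨hKR κ, fun hκ ↦ ?_⟩, hFU κ, fun _ ↦ ?_⟩, ?_, ?_⟩
  · have := hFU κ hκ
    exact isKRSpace_of_frechetUrysohnSpace _
  · exact hKR κ (isKRSpace_of_frechetUrysohnSpace _)
  · have : Nonempty (OrdinalSpace (Ordinal.omega.{u} 1)) := ⟨⟨0, Ordinal.omega_pos 1⟩⟩
    exact (isKappaFrechetUrysohn_Cp countable_Iic_omega_one).isAscoliSpace
  · refine not_isKRSpace_Cp_ordinalSpace ?_
    rw [Cardinal.cof_omega_one, not_le]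
    exact Cardinal.aleph0_lt_aleph_one
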